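/- Let $X,Y$ be finite sets, $f:X\times Y\to\{0,1\}$ a function and $\mu$ a probability distribution on $X\times Y$. All logarithms are to base $2$. A *private-coin protocol* is a finite rooted tree. Each inner node is owned by Alice (who knows $x\in X$) or by Bob (who knows $y\in Y$); the owner sends one of finitely many messages, which correspond to the children of the node, drawn from a distribution that depends on the node and on the owner's input. Each leaf is labelled by an output in $\{0,1\}$. A *protocol* $\pi$ is a discrete probability distribution on private-coin protocols: public randomness $r$, independent of the inputs, is sampled first and the private-coin protocol $\pi_r$ is then run. Its transcript $\Pi$ consists of $r$ and all messages sent, and its output is the label of the leaf reached. For $(X,Y)\sim\mu$, the (internal) *information cost* of $\pi$ is $$\mathrm{IC}_\mu(\pi)=I(\Pi;X\mid Y)+I(\Pi;Y\mid X),$$ where $I(\cdot\,;\cdot\mid\cdot)$ is conditional mutual information in bits. The *information complexity* of $f$ under $\mu$ with error $\rho$ is $$\mathrm{IC}_\mu(f,\rho)=\inf\{\mathrm{IC}_\mu(\pi):\ \Pr[\pi(x,y)\ne f(x,y)]\le\rho\},$$ the probability being over $(x,y)\sim\mu$ and all the coins. A *rectangle* is a set $R\subseteq X\times Y$ such that $(x_1,y_1),(x_2,y_2)\in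 R$ implies $(x_1,y_2)\in R$, and the *discrepancy* of $f$ is $$\mathrm{Disc}_\mu(f)=\max_{R\text{ rectangle}}\bigl|\Pr_\mu[f(x,y)=0\wedge(x,y)\in R]-\Pr_\mu[f(x,y)=1\wedge(x,y)\in R]\bigr|.$$ **Theorem.** $\mathrm{IC}_\mu(f,1/10)\ge\Omega(\log(1/\mathrm{Disc}_\mu(f)))$. That is, there are universal constants $c>0$ and $\delta>0$ such that for all finite $X,Y$, every $f:X\times Y\to\{0,1\}$ and every probability distribution $\mu$ on $X\times Y$ with $\mathrm{Disc}_\mu(f)\le\delta$, $$\mathrm{IC}_\mu(f,1/10)\ \ge\ c\,\log\frac1{\mathrm{Disc}_\mu(f)}.$$ -/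

import Mathlib

noncomputable section

/-! ### Probabilities, entropy and information for discrete random variables -/

/-- The probability of the event `E` under the discrete distribution `p`, as a real number. -/
def prob {S : Type*} (p : PMF S) (E : Set S) : ℝ :=
  (p.toOuterMeasure E).toReal

/-- The conditional probability `Pr[A = a | B = b]`, for `A` and `B` random variables on the
discrete probability space `p`. -/
def condProb {S α β : Type*} (p : PMF S) (A : S → α) (B : S → β) (a : α) (b : β) : ℝ :=
  prob p {s | A s = a ∧ B s = b} / prob p {s | B s = b}

/-- The entropy `∑ₐ Pr[A = a] log₂ (1 / Pr[A = a])`, in bits, of a distribution `q` given by its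
point probabilities. -/
def entropy {α : Type*} (q : α → ℝ) : ℝ :=
  ∑' a, q a * Real.logb 2 (1 / q a)

/-- The conditional entropy `H(A | B) = E_b [H(A | B = b)]`. -/
def condEntropy {S α β : Type*} (p : PMF S) (A : S → α) (B : S → β) : ℝ :=
  ∑' b, prob p {s | B s = b} * entropy (fun a => condProb p A B a b)

/-- The conditional mutual information `I(A ; B | C) = H(A | C) - H(A | B C)`. -/
def condMutualInfo {S α β γ : Type*} (p : PMF S) (A : S → α) (B : S → β) (C : S → γ) : ℝ :=
  condEntropy p A C - condEntropy p A (fun s => (B s, C s))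

/-! ### Two-party protocols -/

/-- A private-coin protocol with inputs in `X` (Alice) and `Y` (Bob) and Boolean output: a finite
rooted tree. A leaf carries the output. An inner node is owned by one of the players; its
children correspond to the `k` messages that the owner may send there, and the owner's input
determines the distribution of the message. -/
inductive PrivateProtocol (X Y : Type*)
  | leaf (out : Bool) : PrivateProtocol X Y
  | alice (k : ℕ) (message : X → PMF (Fin k)) (next : Fin k → PrivateProtocol X Y) :
      PrivateProtocol X Y
  | bob (k : ℕ) (message : Y → PMF (Fin k)) (next : Fin k → PrivateProtocol X Y) :
      PrivateProtocol X Y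

/-- The joint distribution of the sequence of messages sent and of the output, when the protocol
is run on the inputs `x` and `y`. -/
def PrivateProtocol.run {X Y : Type*} (x : X) (y : Y) :
    PrivateProtocol X Y → PMF (List ℕ × Bool)
  | .leaf out => PMF.pure ([], out)
  | .alice _ message next =>
      (message x).bind fun i => (run x y (next i)).map fun t => ((i : ℕ) :: t.1, t.2)
  | .bob _ message next =>
      (message y).bind fun i => (run x y (next i)).map fun t => ((i : ℕ) :: t.1, t.2)

/-- A public-coin protocol: a distribution on private-coin protocols. The shared randomness
`r : Coins` is sampled first, and then the private-coin protocol `tree r` is run. -/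
structure Protocol (X Y : Type*) where
  /-- the values of the public randomness -/
  Coins : Type
  /-- the distribution of the public randomness -/
  coins : PMF Coins
  /-- the private-coin protocol that is run for a value of the public randomness -/
  tree : Coins → PrivateProtocol X Y

/-- The joint distribution of the inputs, of the transcript (the public randomness together with
all messages) and of the output, when the inputs are drawn from `μ` and, independently of them,
the public randomness is sampled. -/
def Protocol.execution {X Y : Type*} (π : Protocol X Y) (μ : PMF (X × Y)) :
    PMF ((X × Y) × (π.Coins × List ℕ) × Bool) :=
  μ.bind fun z => π.coins.bind fun r =>
    ((π.tree r).run z.1 z.2).map fun t => (z, (r, t.1), t.2)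

/-- The probability, over the inputs and all coins, that the output of `π` differs from `f`. -/
def Protocol.error {X Y : Type*} (π : Protocol X Y) (μ : PMF (X × Y)) (f : X → Y → Bool) : ℝ :=
  prob (π.execution μ) {s | s.2.2 ≠ f s.1.1 s.1.2}

/-- The internal information cost `I(X ; Π | Y) + I(Y ; Π | X)`, with `Π` the transcript. -/
def Protocol.infoCost {X Y : Type*} (π : Protocol X Y) (μ : PMF (X × Y)) : ℝ :=
  condMutualInfo (π.execution μ) (fun s => s.1.1) (fun s => s.2.1) (fun s => s.1.2) +
    condMutualInfo (π.execution μ) (fun s => s.1.2) (fun s => s.2.1) (fun s => s.1.1)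

/-- The information complexity of `f` under `μ` with error `ρ`: the infimum of the information
costs of the protocols that err with probability at most `ρ`. -/
def infoComplexity {X Y : Type*} (f : X → Y → Bool) (μ : PMF (X × Y)) (ρ : ℝ) : ℝ :=
  sInf {c : ℝ | ∃ π : Protocol X Y, π.error μ f ≤ ρ ∧ π.infoCost μ = c}

/-! ### Discrepancy -/

/-- Combinatorial rectangles. -/
def IsRectangle {X Y : Type*} (R : Set (X × Y)) : Prop :=
  ∀ x₁ y₁ x₂ y₂, (x₁, y₁) ∈ R → (x₂, y₂) ∈ R → (x₁, y₂) ∈ R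

/-- The discrepancy of `f` with respect to `μ`; the supremum is a maximum when `X` and `Y` are
finite. -/
def discrepancy {X Y : Type*} (f : X → Y → Bool) (μ : PMF (X × Y)) : ℝ :=
  ⨆ R : {R : Set (X × Y) // IsRectangle R},
    |prob μ {z | f z.1 z.2 = false ∧ z ∈ R.1} - prob μ {z | f z.1 z.2 = true ∧ z ∈ R.1}|

end

/-! Fix the public coins. A leaf `j` is reached on inputs `(x, y)` with probability `p x j * q y j`.
Let `qB y j` be Bob's expectation of `p` given `y`, and `pA x j` Alice's expectation of `q` given
`x`. Reaching `j` multiplies Bob's probability of `x` by `p / qB` and Alice's probability of `y` by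
`q / pA`. A protocol of information cost `I` rarely makes either ratio exceed `K = 2 ^ O(I + 1)`, by
a Markov argument (`mul_prob_surprise_le`).

Whenever both ratios are at most `K`, `p * q` equals the truncation `G = min p (K * qB) * min (K *
pA) q`. Since `min` is a positive definite kernel, the sum of `± G` over the leaves is an inner
product of a vector depending on `x` with one depending on `y`. Their squared norms are at most `K`,
because `∑ j, p * pA ≤ 1` and `∑ j, qB * q ≤ 1`. Grothendieck's inequality, proved here with
constant 8, together with the factor 4 between the cut norm and the `∞ → 1` norm, bounds the
correlation of this inner product with `f` by `32 * K * Disc`. A protocol that is mostly correct and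
rarely surprising has constant correlation (`advantage_le_cut`), so `K * Disc` is bounded below and
`I ≥ Ω(log (1 / Disc))` once `Disc` is small. -/

/-! ### Cut norm and the `∞ → 1` norm -/

open Finset in
lemma sum_mul_le_sum_pos {Z : Type*} [Fintype Z] (c e : Z → ℝ) (he : ∀ z, 0 ≤ e z ∧ e z ≤ 1) :
    ∑ z, e z * c z ≤ ∑ z ∈ univ.filter (fun z => 0 < c z), c z := by
  rw [sum_filter]
  refine sum_le_sum fun z _ => ?_
  have := he z
  split_ifs with hz <;> nlinarith

open Finset in
/-- A bilinear form bounded on the vertices of the cube is bounded on the cube `[0, 1]^X × [0, 1]^Y`. -/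
lemma bilin_le_of_subset_le {X Y : Type*} [Fintype X] [Fintype Y] (M : X → Y → ℝ) (D : ℝ)
    (h : ∀ (S : Finset X) (T : Finset Y), ∑ x ∈ S, ∑ y ∈ T, M x y ≤ D)
    (a : X → ℝ) (b : Y → ℝ) (ha : ∀ x, 0 ≤ a x ∧ a x ≤ 1) (hb : ∀ y, 0 ≤ b y ∧ b y ≤ 1) :
    ∑ x, ∑ y, M x y * (a x * b y) ≤ D := by
  -- The form is linear in each argument: round `a` to the best vertex for the given `b`, then `b`
  -- to the best vertex for that `S`.
  set S := univ.filter (fun x => 0 < ∑ y, M x y * b y)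
  calc ∑ x, ∑ y, M x y * (a x * b y) = ∑ x, a x * ∑ y, M x y * b y := by
        refine sum_congr rfl fun x _ => ?_
        rw [mul_sum]
        exact sum_congr rfl fun y _ => by ring
    _ ≤ ∑ x ∈ S, ∑ y, M x y * b y := sum_mul_le_sum_pos _ a ha
    _ = ∑ y, b y * ∑ x ∈ S, M x y := by
        rw [sum_comm]
        refine sum_congr rfl fun y _ => ?_
        rw [mul_sum]
        exact sum_congr rfl fun x _ => by ring
    _ ≤ ∑ y ∈ univ.filter (fun y => 0 < ∑ x ∈ S, M x y), ∑ x ∈ S, M x y := sum_mul_le_sum_pos _ b hb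
    _ ≤ D := by rw [sum_comm]; exact h _ _

open Finset in
/-- The `∞ → 1` norm is at most four times the cut norm. -/
lemma bilin_le_four_mul_cut {X Y : Type*} [Fintype X] [Fintype Y] (M : X → Y → ℝ) (D : ℝ)
    (h : ∀ (S : Finset X) (T : Finset Y), |∑ x ∈ S, ∑ y ∈ T, M x y| ≤ D)
    (a : X → ℝ) (b : Y → ℝ) (ha : ∀ x, |a x| ≤ 1) (hb : ∀ y, |b y| ≤ 1) :
    ∑ x, ∑ y, M x y * (a x * b y) ≤ 4 * D := by
  have hpos := bilin_le_of_subset_le M D fun S T => (abs_le.1 (h S T)).2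
  have hneg := bilin_le_of_subset_le (fun x y => - M x y) D fun S T => by
    simpa using neg_le.1 (abs_le.1 (h S T)).1
  have part : ∀ t : ℝ, |t| ≤ 1 → (0 ≤ max t 0 ∧ max t 0 ≤ 1) ∧ (0 ≤ max (-t) 0 ∧ max (-t) 0 ≤ 1) := by
    intro t ht
    have := abs_le.1 ht
    refine ⟨⟨le_max_right _ _, max_le this.2 zero_le_one⟩, le_max_right _ _, max_le (by linarith) zero_le_one⟩
  have split : ∀ t : ℝ, t = max t 0 - max (-t) 0 := by
    intro t
    rcases le_total t 0 with ht | ht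
    · rw [max_eq_right ht, max_eq_left (by linarith)]; ring
    · rw [max_eq_left ht, max_eq_right (by linarith)]; ring
  have h1 := hpos (fun x => max (a x) 0) (fun y => max (b y) 0) (fun x => (part _ (ha x)).1)
    (fun y => (part _ (hb y)).1)
  have h2 := hpos (fun x => max (-a x) 0) (fun y => max (-b y) 0) (fun x => (part _ (ha x)).2)
    (fun y => (part _ (hb y)).2)
  have h3 := hneg (fun x => max (-a x) 0) (fun y => max (b y) 0) (fun x => (part _ (ha x)).2)
    (fun y => (part _ (hb y)).1)
  have h4 := hneg (fun x => max (a x) 0) (fun y => max (-b y) 0) (fun x => (part _ (ha x)).1)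
    (fun y => (part _ (hb y)).2)
  have key : ∑ x, ∑ y, M x y * (a x * b y) =
      (∑ x, ∑ y, M x y * (max (a x) 0 * max (b y) 0)) +
      (∑ x, ∑ y, M x y * (max (-a x) 0 * max (-b y) 0)) +
      (∑ x, ∑ y, -M x y * (max (-a x) 0 * max (b y) 0)) +
      (∑ x, ∑ y, -M x y * (max (a x) 0 * max (-b y) 0)) := by
    simp only [← sum_add_distrib]
    refine sum_congr rfl fun x _ => sum_congr rfl fun y _ => ?_
    conv_lhs => rw [split (a x), split (b y)]
    ring
  rw [key]
  linarith

/-! ### Grothendieck's inequality -/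

/-- The sign `±1` attached to a Boolean. -/
def boolSign (b : Bool) : ℝ := if b then -1 else 1

/-- The Rademacher sum `∑ᵢ ωᵢ uᵢ` of a vector. -/
def rademacherSum {n : ℕ} (u : Fin n → ℝ) (ω : Fin n → Bool) : ℝ :=
  ∑ i, boolSign (ω i) * u i

lemma sum_rademacher_succ {n : ℕ} (u : Fin (n + 1) → ℝ) (v : Fin (n + 1) → ℝ) (F : ℝ → ℝ → ℝ) :
    ∑ ω, F (rademacherSum u ω) (rademacherSum v ω) =
      ∑ ω, (F (u 0 + rademacherSum (fun i => u i.succ) ω) (v 0 + rademacherSum (fun i => v i.succ) ω) +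
        F (-u 0 + rademacherSum (fun i => u i.succ) ω)
          (-v 0 + rademacherSum (fun i => v i.succ) ω)) := by
  rw [← (Fin.consEquiv fun _ => Bool).sum_comp, Fintype.sum_prod_type, Fintype.sum_bool,
    ← Finset.sum_add_distrib]
  refine Finset.sum_congr rfl fun ω _ => ?_
  simp [rademacherSum, Fin.sum_univ_succ, boolSign, Fin.consEquiv, add_comm]

lemma sum_rademacher_mul {n : ℕ} (u v : Fin n → ℝ) :
    ∑ ω, rademacherSum u ω * rademacherSum v ω = 2 ^ n * ∑ i, u i * v i := by
  induction n with
  | zero => simp [rademacherSum]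
  | succ n ih =>
    rw [sum_rademacher_succ u v fun a b => a * b]
    calc _ = ∑ ω, (2 * (u 0 * v 0) + 2 * (rademacherSum (fun i => u i.succ) ω *
          rademacherSum (fun i => v i.succ) ω)) := Finset.sum_congr rfl fun ω _ => by ring
      _ = _ := by
        simp only [Finset.sum_add_distrib, ← Finset.mul_sum, ih, Fin.sum_univ_succ]
        simp
        ring

/-- Khintchine's inequality for fourth moments. Averaging over the first sign kills the odd powers,
and the remaining `6 * u 0 ^ 2 * s` is exactly the cross term of `3 * (u 0 ^ 2 + s) ^ 2`. -/
lemma sum_rademacher_pow_four_le {n : ℕ} (u : Fin n → ℝ) :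
    ∑ ω, rademacherSum u ω ^ 4 ≤ 2 ^ n * (3 * (∑ i, u i ^ 2) ^ 2) := by
  induction n with
  | zero => simp [rademacherSum]
  | succ n ih =>
    rw [sum_rademacher_succ u u fun a _ => a ^ 4]
    have h2 := sum_rademacher_mul (fun i : Fin n => u i.succ) (fun i => u i.succ)
    have h4 := ih fun i => u i.succ
    set s := ∑ i : Fin n, u i.succ ^ 2 with hs
    have hs' : ∑ i : Fin n, u i.succ * u i.succ = s := Finset.sum_congr rfl fun i _ => by ring
    rw [hs'] at h2
    calc _ = ∑ ω, (2 * u 0 ^ 4 + 12 * u 0 ^ 2 * (rademacherSum (fun i => u i.succ) ω *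
          rademacherSum (fun i => u i.succ) ω) + 2 * rademacherSum (fun i => u i.succ) ω ^ 4) :=
          Finset.sum_congr rfl fun ω _ => by ring
      _ = 2 ^ n * (2 * u 0 ^ 4) + 12 * u 0 ^ 2 * (2 ^ n * s) +
          2 * ∑ ω, rademacherSum (fun i => u i.succ) ω ^ 4 := by
        simp only [Finset.sum_add_distrib, ← Finset.mul_sum, h2]
        simp
        ring
      _ ≤ 2 ^ n * (2 * u 0 ^ 4) + 12 * u 0 ^ 2 * (2 ^ n * s) + 2 * (2 ^ n * (3 * s ^ 2)) := by
        linarith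
      _ ≤ _ := by
        rw [Fin.sum_univ_succ, ← hs, pow_succ (2 : ℝ) n]
        nlinarith [mul_nonneg (show (0 : ℝ) ≤ 2 ^ n by positivity) (show 0 ≤ u 0 ^ 4 by positivity)]

/-- Truncation of a real number to `[-2, 2]`. -/
def clampTwo (t : ℝ) : ℝ := max (-2) (min 2 t)

lemma abs_clampTwo_le (t : ℝ) : |clampTwo t / 2| ≤ 1 := by
  rw [abs_div, abs_two, div_le_one two_pos, abs_le]
  exact ⟨le_max_left _ _, max_le (by norm_num) (min_le_left _ _)⟩

lemma clampTwo_sq_le (t : ℝ) : clampTwo t ^ 2 ≤ t ^ 2 := by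
  unfold clampTwo
  rcases le_total 2 t with h | h
  · rw [min_eq_left h, max_eq_right (by norm_num)]; nlinarith
  · rw [min_eq_right h]
    rcases le_total (-2) t with h' | h'
    · rw [max_eq_right h']
    · rw [max_eq_left h']; nlinarith

/-- For an excess `z` over the level 2 this is `8 * z ≤ (z + 2) ^ 2`, squared. With a fourth moment
of at most 3, four times the truncation error still lies in the unit ball of `L²`. -/
lemma sub_clampTwo_sq_le (t : ℝ) : (4 * (t - clampTwo t)) ^ 2 ≤ t ^ 4 / 4 := by
  have key : ∀ z : ℝ, 0 ≤ z → (4 * z) ^ 2 ≤ (z + 2) ^ 4 / 4 := by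
    intro z hz
    have h1 : 8 * z ≤ (z + 2) ^ 2 := by nlinarith [sq_nonneg (z - 2)]
    have h2 : (8 * z) ^ 2 ≤ ((z + 2) ^ 2) ^ 2 := pow_le_pow_left₀ (by positivity) h1 2
    nlinarith
  unfold clampTwo
  rcases le_total 2 t with h | h
  · rw [min_eq_left h, max_eq_right (by norm_num)]
    have := key (t - 2) (by linarith)
    simpa using this
  · rw [min_eq_right h]
    rcases le_total (-2) t with h' | h'
    · rw [max_eq_right h']; simp; positivity
    · rw [max_eq_left h']
      have := key (-2 - t) (by linarith)
      calc _ = (4 * (-2 - t)) ^ 2 := by ring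
        _ ≤ _ := this
        _ = _ := by ring

/-- `C` bounds the form `M` on all families of vectors in the unit balls of the spaces `ℝⁿ`. -/
def VectorBound {X Y : Type*} [Fintype X] [Fintype Y] (M : X → Y → ℝ) (C : ℝ) : Prop :=
  ∀ (n : ℕ) (u : X → Fin n → ℝ) (v : Y → Fin n → ℝ), (∀ x, ∑ i, u x i ^ 2 ≤ 1) →
    (∀ y, ∑ i, v y i ^ 2 ≤ 1) → ∑ x, ∑ y, M x y * ∑ i, u x i * v y i ≤ C

/-- The same bound for vectors in a finite weighted `L²` space; the square roots of the weights are
absorbed into the coordinates. -/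
lemma VectorBound.weighted {X Y ι : Type*} [Fintype X] [Fintype Y] [Fintype ι] {M : X → Y → ℝ}
    {C : ℝ} (h : VectorBound M C) (w : ι → ℝ) (hw : ∀ i, 0 ≤ w i) (u : X → ι → ℝ) (v : Y → ι → ℝ)
    (hu : ∀ x, ∑ i, w i * u x i ^ 2 ≤ 1) (hv : ∀ y, ∑ i, w i * v y i ^ 2 ≤ 1) :
    ∑ x, ∑ y, M x y * ∑ i, w i * (u x i * v y i) ≤ C := by
  let e := (Fintype.equivFin ι).symm
  have := h (Fintype.card ι) (fun x i => √(w (e i)) * u x (e i)) (fun y i => √(w (e i)) * v y (e i))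
    (fun x => by
      rw [e.sum_comp fun i => (√(w i) * u x i) ^ 2]
      simpa [mul_pow, Real.sq_sqrt, hw] using hu x)
    (fun y => by
      rw [e.sum_comp fun i => (√(w i) * v y i) ^ 2]
      simpa [mul_pow, Real.sq_sqrt, hw] using hv y)
  refine le_of_eq_of_le ?_ this
  refine Finset.sum_congr rfl fun x _ => Finset.sum_congr rfl fun y _ => ?_
  rw [e.sum_comp fun i => √(w i) * u x i * (√(w i) * v y i)]
  congr 1
  refine Finset.sum_congr rfl fun i _ => ?_
  rw [mul_mul_mul_comm, Real.mul_self_sqrt (hw i)]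

lemma VectorBound.trivial {X Y : Type*} [Fintype X] [Fintype Y] (M : X → Y → ℝ) :
    VectorBound M (∑ x, ∑ y, |M x y|) := by
  intro n u v hu hv
  refine Finset.sum_le_sum fun x _ => Finset.sum_le_sum fun y _ => ?_
  have hcs := Finset.sum_mul_sq_le_sq_mul_sq Finset.univ (u x) (v y)
  have h1 : (∑ i, u x i * v y i) ^ 2 ≤ 1 := hcs.trans <|
    mul_le_one₀ (hu x) (Finset.sum_nonneg fun i _ => sq_nonneg _) (hv y)
  have h2 : |∑ i, u x i * v y i| ≤ 1 := by
    rwa [← sq_le_one_iff_abs_le_one]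
  calc _ ≤ |M x y * ∑ i, u x i * v y i| := le_abs_self _
    _ = |M x y| * |∑ i, u x i * v y i| := abs_mul _ _
    _ ≤ |M x y| := mul_le_of_le_one_right (abs_nonneg _) h2

/-- Replace vectors by their Rademacher sums, which preserves inner products, and truncate. The
bounded parts are handled pointwise by `hD`, at cost `2 * 2 * D`; each of the two error terms
contains a vector of norm at most `1 / 4`, so the old bound gives `C / 4` for it. The dimension
grows from `n` to `2 ^ n`, which is why `VectorBound` ranges over all dimensions. -/
lemma VectorBound.step {X Y : Type*} [Fintype X] [Fintype Y] {M : X → Y → ℝ} {C D : ℝ}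
    (hD : ∀ (a : X → ℝ) (b : Y → ℝ), (∀ x, |a x| ≤ 1) → (∀ y, |b y| ≤ 1) →
      ∑ x, ∑ y, M x y * (a x * b y) ≤ D)
    (h : VectorBound M C) : VectorBound M (4 * D + C / 2) := by
  intro n u v hu hv
  have hN : (0 : ℝ) < 2 ^ n := by positivity
  set N : ℝ := 2 ^ n with hNdef
  have second : ∀ a : Fin n → ℝ, ∑ i, a i ^ 2 ≤ 1 → ∑ ω, N⁻¹ * rademacherSum a ω ^ 2 ≤ 1 := by
    intro a ha
    rw [← Finset.mul_sum]
    have := sum_rademacher_mul a a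
    simp only [← sq] at this
    rw [this, ← mul_assoc, inv_mul_cancel₀ hN.ne', one_mul]
    exact ha
  have secondClamp : ∀ a : Fin n → ℝ, ∑ i, a i ^ 2 ≤ 1 →
      ∑ ω, N⁻¹ * clampTwo (rademacherSum a ω) ^ 2 ≤ 1 := by
    intro a ha
    refine le_trans (Finset.sum_le_sum fun ω _ => ?_) (second a ha)
    exact mul_le_mul_of_nonneg_left (clampTwo_sq_le _) (by positivity)
  have tail : ∀ a : Fin n → ℝ, ∑ i, a i ^ 2 ≤ 1 →
      ∑ ω, N⁻¹ * (4 * (rademacherSum a ω - clampTwo (rademacherSum a ω))) ^ 2 ≤ 1 := by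
    intro a ha
    calc _ ≤ ∑ ω, N⁻¹ * (rademacherSum a ω ^ 4 / 4) := Finset.sum_le_sum fun ω _ =>
          mul_le_mul_of_nonneg_left (sub_clampTwo_sq_le _) (by positivity)
      _ = N⁻¹ * (∑ ω, rademacherSum a ω ^ 4) / 4 := by
        rw [← Finset.mul_sum, ← Finset.sum_div]; ring
      _ ≤ N⁻¹ * (N * (3 * (∑ i, a i ^ 2) ^ 2)) / 4 := by
        have := sum_rademacher_pow_four_le a
        gcongr
      _ = 3 / 4 * (∑ i, a i ^ 2) ^ 2 := by
        rw [← mul_assoc, inv_mul_cancel₀ hN.ne']; ring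
      _ ≤ 1 := by
        have : (∑ i, a i ^ 2) ^ 2 ≤ 1 :=
          pow_le_one₀ (Finset.sum_nonneg fun i _ => sq_nonneg _) ha
        linarith
  have hw : ∀ ω : Fin n → Bool, 0 ≤ N⁻¹ := fun _ => by positivity
  have b1 := h.weighted (fun _ : Fin n → Bool => N⁻¹) hw
    (fun x ω => 4 * (rademacherSum (u x) ω - clampTwo (rademacherSum (u x) ω)))
    (fun y ω => clampTwo (rademacherSum (v y) ω)) (fun x => tail _ (hu x))
    (fun y => secondClamp _ (hv y))
  have b2 := h.weighted (fun _ : Fin n → Bool => N⁻¹) hw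
    (fun x ω => rademacherSum (u x) ω)
    (fun y ω => 4 * (rademacherSum (v y) ω - clampTwo (rademacherSum (v y) ω)))
    (fun x => second _ (hu x)) (fun y => tail _ (hv y))
  have b3 : ∑ x, ∑ y, M x y * ∑ ω, N⁻¹ * (clampTwo (rademacherSum (u x) ω) *
      clampTwo (rademacherSum (v y) ω)) ≤ 4 * D := by
    calc _ = ∑ ω, 4 * N⁻¹ * ∑ x, ∑ y, M x y * (clampTwo (rademacherSum (u x) ω) / 2 *
          (clampTwo (rademacherSum (v y) ω) / 2)) := by
          simp only [Finset.mul_sum]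
          conv_rhs => rw [Finset.sum_comm]
          refine Finset.sum_congr rfl fun x _ => ?_
          rw [Finset.sum_comm]
          refine Finset.sum_congr rfl fun ω _ => Finset.sum_congr rfl fun y _ => ?_
          ring
      _ ≤ ∑ _ω : Fin n → Bool, 4 * N⁻¹ * D := Finset.sum_le_sum fun ω _ =>
          mul_le_mul_of_nonneg_left (hD _ _ (fun x => abs_clampTwo_le _)
            (fun y => abs_clampTwo_le _)) (by positivity)
      _ = 4 * D := by
        simp
        rw [← hNdef]
        field_simp
  -- With `U'`, `V'` the truncations, `U * V = U' * V' + (U - U') * V' + U * (V - V')`.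
  have key : ∑ x, ∑ y, M x y * ∑ i, u x i * v y i =
      (∑ x, ∑ y, M x y * ∑ ω, N⁻¹ * (clampTwo (rademacherSum (u x) ω) *
        clampTwo (rademacherSum (v y) ω))) +
      (∑ x, ∑ y, M x y * ∑ ω, N⁻¹ * (4 * (rademacherSum (u x) ω -
        clampTwo (rademacherSum (u x) ω)) * clampTwo (rademacherSum (v y) ω))) / 4 +
      (∑ x, ∑ y, M x y * ∑ ω, N⁻¹ * (rademacherSum (u x) ω * (4 * (rademacherSum (v y) ω -
        clampTwo (rademacherSum (v y) ω))))) / 4 := by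
    simp only [Finset.sum_div, ← Finset.sum_add_distrib]
    refine Finset.sum_congr rfl fun x _ => Finset.sum_congr rfl fun y _ => ?_
    have h2 : ∑ i, u x i * v y i = ∑ ω, N⁻¹ * (rademacherSum (u x) ω * rademacherSum (v y) ω) := by
      rw [← Finset.mul_sum, sum_rademacher_mul, ← mul_assoc, inv_mul_cancel₀ hN.ne', one_mul]
    rw [h2, mul_div_assoc, mul_div_assoc, ← mul_add, ← mul_add, Finset.sum_div, Finset.sum_div,
      ← Finset.sum_add_distrib, ← Finset.sum_add_distrib]
    congr 1
    exact Finset.sum_congr rfl fun ω _ => by ring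
  rw [key]
  linarith

/-- **Grothendieck's inequality**, with constant `8`. -/
theorem grothendieck_inequality {X Y : Type*} [Fintype X] [Fintype Y] {M : X → Y → ℝ} {D : ℝ}
    (hD : ∀ (a : X → ℝ) (b : Y → ℝ), (∀ x, |a x| ≤ 1) → (∀ y, |b y| ≤ 1) →
      ∑ x, ∑ y, M x y * (a x * b y) ≤ D) : VectorBound M (8 * D) := by
  set C := ∑ x, ∑ y, |M x y|
  -- `8 * D` is the attracting fixed point of `C ↦ 4 * D + C / 2`; the trivial bound starts the
  -- iteration.
  have iter : ∀ k : ℕ, VectorBound M (8 * D + (C - 8 * D) * (1 / 2) ^ k) := by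
    intro k
    induction k with
    | zero => simpa using VectorBound.trivial M
    | succ k ih =>
      have := ih.step hD
      rw [pow_succ]
      convert this using 1
      ring
  intro n u v hu hv
  have lim : Filter.Tendsto (fun k : ℕ => 8 * D + (C - 8 * D) * (1 / 2 : ℝ) ^ k) Filter.atTop
      (nhds (8 * D + (C - 8 * D) * 0)) :=
    ((tendsto_pow_atTop_nhds_zero_of_lt_one (by norm_num) (by norm_num)).const_mul _).const_add _
  rw [mul_zero, add_zero] at lim
  exact ge_of_tendsto' lim fun k => iter k n u v hu hv

/-! ### Minima as inner products -/

/-- Nonnegative reals from a finite set are the masses of initial segments, for a suitable weight. -/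
lemma exists_layer_weights (V : Finset ℝ) (hV : ∀ a ∈ V, 0 ≤ a) :
    ∃ w : ℝ → ℝ, (∀ v, 0 ≤ w v) ∧ ∀ a ∈ V, ∑ v ∈ V, w v * (if v ≤ a then 1 else 0) = a := by
  induction V using Finset.induction_on_max with
  | empty => exact ⟨0, by simp, by simp⟩
  | insert m V hm ih =>
    obtain ⟨w, hw, hsum⟩ := ih fun a ha => hV a (Finset.mem_insert_of_mem ha)
    have hmV : m ∉ V := fun h => lt_irrefl _ (hm m h)
    have total : ∑ v ∈ V, w v ≤ m := by
      rcases V.eq_empty_or_nonempty with rfl | hne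
      · simpa using hV m (by simp)
      · have := hsum _ (V.max'_mem hne)
        rw [Finset.sum_congr rfl fun v hv => by rw [if_pos (V.le_max' v hv), mul_one]] at this
        rw [this]
        exact (hm _ (V.max'_mem hne)).le
    -- The new weight is the gap between `m` and the previous maximum (or 0 if there is none).
    refine ⟨Function.update w m (m - ∑ v ∈ V, w v), fun v => ?_, fun a ha => ?_⟩
    · rcases eq_or_ne v m with rfl | h
      · simpa using total
      · simpa [h] using hw v
    · set t := m - ∑ v ∈ V, w v
      have hupd : ∀ g : ℝ → ℝ, ∑ v ∈ V, Function.update w m t v * g v = ∑ v ∈ V, w v * g v :=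
        fun g => Finset.sum_congr rfl fun v hv => by rw [Function.update_of_ne (hm v hv).ne]
      rw [Finset.sum_insert hmV, hupd, Function.update_self]
      rcases Finset.mem_insert.1 ha with rfl | ha
      · have : ∑ v ∈ V, w v * (if v ≤ a then 1 else 0) = ∑ v ∈ V, w v :=
          Finset.sum_congr rfl fun v hv => by rw [if_pos (hm v hv).le, mul_one]
        rw [this]
        simp [t]
      · rw [hsum a ha, if_neg (not_le.2 (hm a ha))]
        simp

lemma layer_weights_min {V : Finset ℝ} {w : ℝ → ℝ}
    (h : ∀ a ∈ V, ∑ v ∈ V, w v * (if v ≤ a then 1 else 0) = a) {a b : ℝ} (ha : a ∈ V)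
    (hb : b ∈ V) :
    ∑ v ∈ V, w v * ((if v ≤ a then 1 else 0) * (if v ≤ b then 1 else 0)) = min a b := by
  have hm : min a b ∈ V := by rcases min_choice a b with e | e <;> rw [e] <;> assumption
  rw [← h _ hm]
  refine Finset.sum_congr rfl fun v _ => ?_
  by_cases h1 : v ≤ a <;> by_cases h2 : v ≤ b <;> simp [h1, h2]

/-- Grothendieck's inequality for the positive kernels built from minima. -/
lemma VectorBound.min_kernel {X Y ι : Type*} [Fintype X] [Fintype Y] [Fintype ι] {M : X → Y → ℝ}
    {C K : ℝ} (hM : VectorBound M C) (hK : 0 < K) (a b : X → ι → ℝ) (c d : Y → ι → ℝ) (σ : ι → ℝ)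
    (hσ : ∀ j, σ j ^ 2 = 1) (ha : ∀ x j, 0 ≤ a x j) (hb : ∀ x j, 0 ≤ b x j)
    (hc : ∀ y j, 0 ≤ c y j) (hd : ∀ y j, 0 ≤ d y j)
    (hab : ∀ x, ∑ j, a x j * b x j ≤ K) (hcd : ∀ y, ∑ j, c y j * d y j ≤ K) :
    ∑ x, ∑ y, M x y * ∑ j, σ j * (min (a x j) (c y j) * min (b x j) (d y j)) ≤ K * C := by
  classical
  let V : Finset ℝ := (Finset.univ.image fun z : X × ι => a z.1 z.2) ∪
    (Finset.univ.image fun z : X × ι => b z.1 z.2) ∪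
    (Finset.univ.image fun z : Y × ι => c z.1 z.2) ∪
    (Finset.univ.image fun z : Y × ι => d z.1 z.2)
  have haV : ∀ x j, a x j ∈ V := fun x j => by
    simp only [V, Finset.mem_union, Finset.mem_image]
    exact .inl (.inl (.inl ⟨(x, j), by simp⟩))
  have hbV : ∀ x j, b x j ∈ V := fun x j => by
    simp only [V, Finset.mem_union, Finset.mem_image]
    exact .inl (.inl (.inr ⟨(x, j), by simp⟩))
  have hcV : ∀ y j, c y j ∈ V := fun y j => by
    simp only [V, Finset.mem_union, Finset.mem_image]
    exact .inl (.inr ⟨(y, j), by simp⟩)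
  have hdV : ∀ y j, d y j ∈ V := fun y j => by
    simp only [V, Finset.mem_union, Finset.mem_image]
    exact .inr ⟨(y, j), by simp⟩
  have hV : ∀ t ∈ V, 0 ≤ t := by
    intro t ht
    simp only [V, Finset.mem_union, Finset.mem_image] at ht
    rcases ht with ((⟨z, -, rfl⟩ | ⟨z, -, rfl⟩) | ⟨z, -, rfl⟩) | ⟨z, -, rfl⟩
    exacts [ha _ _, hb _ _, hc _ _, hd _ _]
  obtain ⟨w, hw, hsum⟩ := exists_layer_weights V hV
  -- A product of two minima is the inner product of tensor products of threshold indicators. The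
  -- scalars `s`, `s'` allow the sign `σ` to be put on the `y` side alone, where it leaves norms
  -- unchanged.
  have tensor : ∀ {e f g h : ℝ} (s s' : ℝ), e ∈ V → f ∈ V → g ∈ V → h ∈ V →
      ∑ v : V, ∑ v' : V, K⁻¹ * (w v * w v') *
        ((if (v : ℝ) ≤ e then 1 else 0) * (if (v' : ℝ) ≤ f then 1 else 0) * s *
          ((if (v : ℝ) ≤ g then 1 else 0) * (if (v' : ℝ) ≤ h then 1 else 0) * s')) =
        K⁻¹ * (s * s' * (min e g * min f h)) := by
    intro e f g h s s' he hf hg hh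
    rw [← layer_weights_min hsum he hg, ← layer_weights_min hsum hf hh, ← Finset.sum_coe_sort V,
      ← Finset.sum_coe_sort V, Finset.sum_mul_sum, Finset.mul_sum, Finset.mul_sum]
    refine Finset.sum_congr rfl fun v _ => ?_
    rw [Finset.mul_sum, Finset.mul_sum]
    exact Finset.sum_congr rfl fun v' _ => by ring
  have key := hM.weighted (ι := ι × V × V) (fun i => K⁻¹ * (w i.2.1 * w i.2.2))
    (fun i => mul_nonneg (by positivity) (mul_nonneg (hw _) (hw _)))
    (fun x i => (if (i.2.1 : ℝ) ≤ a x i.1 then 1 else 0) *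
      (if (i.2.2 : ℝ) ≤ b x i.1 then 1 else 0) * 1)
    (fun y i => (if (i.2.1 : ℝ) ≤ c y i.1 then 1 else 0) *
      (if (i.2.2 : ℝ) ≤ d y i.1 then 1 else 0) * σ i.1)
    (fun x => by
      simp only [Fintype.sum_prod_type, sq]
      rw [Finset.sum_congr rfl fun j _ => tensor 1 1 (haV x j) (hbV x j) (haV x j) (hbV x j)]
      simp only [min_self, one_mul]
      rw [← Finset.mul_sum, inv_mul_le_one₀ hK]
      exact hab x)
    (fun y => by
      simp only [Fintype.sum_prod_type, sq]
      rw [Finset.sum_congr rfl fun j _ =>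
        tensor (σ j) (σ j) (hcV y j) (hdV y j) (hcV y j) (hdV y j)]
      simp only [min_self, ← sq (σ _), hσ, one_mul]
      rw [← Finset.mul_sum, inv_mul_le_one₀ hK]
      exact hcd y)
  have eval : ∀ x y, ∑ i : ι × V × V, K⁻¹ * (w i.2.1 * w i.2.2) *
      ((if (i.2.1 : ℝ) ≤ a x i.1 then 1 else 0) * (if (i.2.2 : ℝ) ≤ b x i.1 then 1 else 0) * 1 *
      ((if (i.2.1 : ℝ) ≤ c y i.1 then 1 else 0) * (if (i.2.2 : ℝ) ≤ d y i.1 then 1 else 0) *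
        σ i.1)) = K⁻¹ * ∑ j, σ j * (min (a x j) (c y j) * min (b x j) (d y j)) := by
    intro x y
    simp only [Fintype.sum_prod_type]
    rw [Finset.sum_congr rfl fun j _ => tensor 1 (σ j) (haV x j) (hbV x j) (hcV y j) (hdV y j),
      Finset.mul_sum]
    simp only [one_mul]
  simp only [eval, mul_left_comm _ K⁻¹, ← Finset.mul_sum] at key
  rwa [inv_mul_le_iff₀ hK] at key

/-! ### Correlation of an unsurprising protocol with `f` -/

open Classical in
/-- A two-party communication pattern whose transcripts have product form `p x j * q y j`: unless
it errs often, or one of the players is often surprised by more than a factor `K`, the cut norm of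
the signed distribution is at least of order `1 / K`. -/
lemma advantage_le_cut {X Y ι : Type*} [Fintype X] [Fintype Y] [Fintype ι] (m ε : X → Y → ℝ)
    {D K : ℝ} (hK : 0 < K) (hm : ∀ x y, 0 ≤ m x y) (hε : ∀ x y, ε x y = 1 ∨ ε x y = -1)
    (hcut : ∀ (S : Finset X) (T : Finset Y), |∑ x ∈ S, ∑ y ∈ T, m x y * ε x y| ≤ D)
    (p : X → ι → ℝ) (q : Y → ι → ℝ) (hp : ∀ x j, 0 ≤ p x j) (hq : ∀ y j, 0 ≤ q y j)
    (hpq : ∀ x y, ∑ j, p x j * q y j = 1) (σ : ι → ℝ) (hσ : ∀ j, σ j = 1 ∨ σ j = -1)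
    (bad₁ bad₂ : X → Y → ι → Prop)
    (h₁ : ∀ x y j, 0 < m x y * (p x j * q y j) → ¬ bad₁ x y j →
      p x j * ∑ x', m x' y ≤ K * ∑ x', m x' y * p x' j)
    (h₂ : ∀ x y j, 0 < m x y * (p x j * q y j) → ¬ bad₂ x y j →
      q y j * ∑ y', m x y' ≤ K * ∑ y', m x y' * q y' j) :
    ∑ x, ∑ y, ∑ j, m x y * (p x j * q y j) * (1 - 2 * (if ε x y ≠ σ j then 1 else 0) -
      (if bad₁ x y j then 1 else 0) - (if bad₂ x y j then 1 else 0)) ≤ 32 * (K * D) := by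
  -- Each player's prediction of the other's factor. On an input of marginal mass 0 the value is `0
  -- / 0 = 0`, for which the norm bounds below still hold.
  set qB : Y → ι → ℝ := fun y j => (∑ x', m x' y * p x' j) / ∑ x', m x' y with hqB
  set pA : X → ι → ℝ := fun x j => (∑ y', m x y' * q y' j) / ∑ y', m x y' with hpA
  have hqB0 : ∀ y j, 0 ≤ qB y j := fun y j => div_nonneg
    (Finset.sum_nonneg fun x _ => mul_nonneg (hm _ _) (hp _ _)) (Finset.sum_nonneg fun x _ => hm _ _)
  have hpA0 : ∀ x j, 0 ≤ pA x j := fun x j => div_nonneg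
    (Finset.sum_nonneg fun y _ => mul_nonneg (hm _ _) (hq _ _)) (Finset.sum_nonneg fun y _ => hm _ _)
  -- Averaging `hpq` over `y'` gives total mass 1, or 0 when `x` has no mass.
  have hpA1 : ∀ x, ∑ j, p x j * (K * pA x j) ≤ K := by
    intro x
    have : ∑ j, p x j * (K * pA x j) = K * ((∑ y', m x y') / ∑ y', m x y') := by
      calc _ = K * ((∑ j, ∑ y', m x y' * (p x j * q y' j)) / ∑ y', m x y') := by
            rw [Finset.sum_div, Finset.mul_sum]
            refine Finset.sum_congr rfl fun j _ => ?_
            rw [hpA, mul_left_comm, mul_div_assoc', Finset.mul_sum]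
            congr 2
            exact Finset.sum_congr rfl fun y _ => by ring
        _ = _ := by
            rw [Finset.sum_comm]
            simp only [← Finset.mul_sum, hpq, mul_one]
    rw [this]
    exact mul_le_of_le_one_right hK.le (div_self_le_one _)
  have hqB1 : ∀ y, ∑ j, (K * qB y j) * q y j ≤ K := by
    intro y
    have : ∑ j, (K * qB y j) * q y j = K * ((∑ x', m x' y) / ∑ x', m x' y) := by
      calc _ = K * ((∑ j, ∑ x', m x' y * (p x' j * q y j)) / ∑ x', m x' y) := by
            rw [Finset.sum_div, Finset.mul_sum]
            refine Finset.sum_congr rfl fun j _ => ?_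
            rw [hqB, mul_assoc, div_mul_eq_mul_div, Finset.sum_mul]
            congr 2
            exact Finset.sum_congr rfl fun x _ => by ring
        _ = _ := by
            rw [Finset.sum_comm]
            simp only [← Finset.mul_sum, hpq, mul_one]
    rw [this]
    exact mul_le_of_le_one_right hK.le (div_self_le_one _)
  have upper := (grothendieck_inequality (bilin_le_four_mul_cut _ _ hcut)).min_kernel hK
    p (fun x j => K * pA x j) (fun y j => K * qB y j) q σ
    (fun j => by rcases hσ j with h | h <;> simp [h]) hp (fun x j => mul_nonneg hK.le (hpA0 x j))
    (fun y j => mul_nonneg hK.le (hqB0 y j)) hq hpA1 hqB1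
  refine le_trans ?_ (upper.trans_eq (by ring))
  refine Finset.sum_le_sum fun x _ => Finset.sum_le_sum fun y _ => ?_
  rw [Finset.mul_sum]
  refine Finset.sum_le_sum fun j _ => ?_
  set G := min (p x j) (K * qB y j) * min (K * pA x j) (q y j) with hG
  have hG0 : 0 ≤ G := mul_nonneg (le_min (hp _ _) (mul_nonneg hK.le (hqB0 _ _)))
    (le_min (mul_nonneg hK.le (hpA0 _ _)) (hq _ _))
  have hG1 : G ≤ p x j * q y j := mul_le_mul (min_le_left _ _) (min_le_right _ _)
    (le_min (mul_nonneg hK.le (hpA0 _ _)) (hq _ _)) (hp _ _)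
  have hgood : 0 < m x y * (p x j * q y j) → ¬ bad₁ x y j → ¬ bad₂ x y j →
      G = p x j * q y j := by
    intro hpos hb1 hb2
    have hmpos : 0 < m x y := (hm x y).lt_of_ne' fun h => by simp [h] at hpos
    have e1 : p x j ≤ K * qB y j := by
      rw [hqB, mul_div_assoc', le_div_iff₀]
      · exact h₁ x y j hpos hb1
      · exact hmpos.trans_le (Finset.single_le_sum (f := fun x' => m x' y) (fun i _ => hm _ _)
          (Finset.mem_univ x))
    have e2 : q y j ≤ K * pA x j := by
      rw [hpA, mul_div_assoc', le_div_iff₀]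
      · exact h₂ x y j hpos hb2
      · exact hmpos.trans_le (Finset.single_le_sum (f := fun y' => m x y') (fun i _ => hm _ _)
          (Finset.mem_univ y))
    rw [hG, min_eq_left e1, min_eq_right e2]
  -- On good leaves `G = p * q` gives equality. On bad ones the left factor is at most 0 for a
  -- correct output and at most -1 for a wrong one, so `0 ≤ G ≤ p * q` suffices.
  have hkey : m x y * (p x j * q y j) * (1 - 2 * (if ε x y ≠ σ j then 1 else 0) -
      (if bad₁ x y j then 1 else 0) - (if bad₂ x y j then 1 else 0)) ≤
      m x y * (if ε x y ≠ σ j then -G else G) := by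
    have hmG : 0 ≤ m x y * G := mul_nonneg (hm _ _) hG0
    have hmG1 : m x y * G ≤ m x y * (p x j * q y j) := mul_le_mul_of_nonneg_left hG1 (hm _ _)
    rcases (mul_nonneg (hm x y) (mul_nonneg (hp x j) (hq y j))).eq_or_lt with h0 | hpos
    · rw [← h0] at hmG1 ⊢
      split_ifs <;> linarith
    · by_cases b1 : bad₁ x y j <;> by_cases b2 : bad₂ x y j <;> by_cases he : ε x y = σ j <;>
        simp only [b1, b2, he, ne_eq, not_true, not_false_iff, if_true, if_false] <;>
        try nlinarith
      rw [hgood hpos b1 b2]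
      linarith
  refine hkey.trans_eq ?_
  rcases hε x y with e | e <;> rcases hσ j with s | s <;> rw [e, s] <;> norm_num

/-! ### Probabilities of events -/

lemma prob_eq_tsum {S : Type*} (p : PMF S) (E : Set S) :
    prob p E = (∑' s, E.indicator p s).toReal := by
  rw [prob, PMF.toOuterMeasure_apply]

lemma prob_ne_top {S : Type*} (p : PMF S) (E : Set S) : p.toOuterMeasure E ≠ ⊤ := by
  refine ne_top_of_le_ne_top ENNReal.one_ne_top ?_
  rw [PMF.toOuterMeasure_apply, ← p.tsum_coe]
  exact ENNReal.tsum_le_tsum fun s => Set.indicator_le_self _ _ _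

lemma prob_nonneg {S : Type*} (p : PMF S) (E : Set S) : 0 ≤ prob p E := ENNReal.toReal_nonneg

lemma prob_mono {S : Type*} (p : PMF S) {E F : Set S} (h : E ⊆ F) : prob p E ≤ prob p F :=
  ENNReal.toReal_mono (prob_ne_top p F) (p.toOuterMeasure.mono h)

lemma prob_univ {S : Type*} (p : PMF S) : prob p Set.univ = 1 := by
  simp [prob_eq_tsum, p.tsum_coe]

lemma prob_le_one {S : Type*} (p : PMF S) (E : Set S) : prob p E ≤ 1 :=
  prob_univ p ▸ prob_mono p (Set.subset_univ E)

/-- The law of total probability. -/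
lemma hasSum_prob_fiber {S β : Type*} (p : PMF S) (B : S → β) (E : Set S) :
    HasSum (fun b => prob p {s | B s = b ∧ s ∈ E}) (prob p E) := by
  have h : p.toOuterMeasure E = ∑' b, p.toOuterMeasure {s | B s = b ∧ s ∈ E} := by
    simp only [PMF.toOuterMeasure_apply]
    rw [ENNReal.tsum_comm]
    refine tsum_congr fun s => ?_
    rw [tsum_eq_single (B s)]
    · by_cases hs : s ∈ E <;> simp [Set.indicator, hs]
    · intro b hb
      simp [Set.indicator, hb.symm]
  have := ENNReal.hasSum_toReal (f := fun b => p.toOuterMeasure {s | B s = b ∧ s ∈ E})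
    (h ▸ prob_ne_top p E)
  rw [← ENNReal.tsum_toReal_eq fun b => prob_ne_top p _, ← h] at this
  exact this

lemma sum_prob_fiber {S α : Type*} [Fintype α] (p : PMF S) (A : S → α) (E : Set S) :
    ∑ a, prob p {s | A s = a ∧ s ∈ E} = prob p E :=
  (hasSum_fintype _).unique (hasSum_prob_fiber p A E)

lemma prob_bind {S T : Type*} (p : PMF S) (k : S → PMF T) (E : Set T) :
    HasSum (fun s => (p s).toReal * prob (k s) E) (prob (p.bind k) E) := by
  have h : (p.bind k).toOuterMeasure E = ∑' s, p s * (k s).toOuterMeasure E :=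
    PMF.toOuterMeasure_bind_apply _ _ _
  have := ENNReal.hasSum_toReal (f := fun s => p s * (k s).toOuterMeasure E)
    (h ▸ prob_ne_top _ E)
  rw [← ENNReal.tsum_toReal_eq fun s => ENNReal.mul_ne_top (p.apply_ne_top s) (prob_ne_top _ _),
    ← h] at this
  simpa [prob] using this

lemma prob_map {S T : Type*} (p : PMF S) (g : S → T) (E : Set T) :
    prob (p.map g) E = prob p (g ⁻¹' E) := by
  rw [prob, prob, PMF.toOuterMeasure_map_apply]

open Classical in
lemma prob_pure {S : Type*} (s : S) (E : Set S) : prob (PMF.pure s) E = if s ∈ E then 1 else 0 := by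
  rw [prob, PMF.toOuterMeasure_pure_apply]
  split_ifs <;> simp

/-! ### Entropy and information density -/

lemma entropy_condProb {S α β : Type*} [Fintype α] (p : PMF S) (A : S → α) (B : S → β) (b : β) :
    prob p {s | B s = b} * entropy (fun a => condProb p A B a b) =
      ∑ a, prob p {s | A s = a ∧ B s = b} *
        Real.logb 2 (prob p {s | B s = b} / prob p {s | A s = a ∧ B s = b}) := by
  rw [entropy, tsum_fintype, Finset.mul_sum]
  refine Finset.sum_congr rfl fun a _ => ?_
  rcases eq_or_ne (prob p {s | B s = b}) 0 with h | h
  · have : prob p {s | A s = a ∧ B s = b} = 0 :=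
      le_antisymm (h ▸ prob_mono p fun s hs => hs.2) (prob_nonneg _ _)
    simp [h, this]
  · rw [condProb, one_div_div, ← mul_assoc, mul_div_cancel₀ _ h]

lemma logb_two_le (z : ℝ) (hz : 0 ≤ z) : Real.logb 2 z ≤ 2 * z := by
  rcases hz.eq_or_lt with rfl | hz
  · simp
  have hlog : (1 / 2 : ℝ) < Real.log 2 := by have := Real.log_two_gt_d9; linarith
  rw [Real.logb, div_le_iff₀ (by linarith)]
  have := Real.log_le_sub_one_of_pos hz
  nlinarith

/-- **Markov's inequality for the information density**: the probability that observing `B`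
multiplies the conditional probability of `A` given `C` by more than `2 ^ Δ` is at most
`(I(A ; B | C) + 2) / Δ`. -/
theorem mul_prob_surprise_le {S α β γ : Type*} [Fintype α] [Fintype γ] (p : PMF S)
    (A : S → α) (B : S → β) (C : S → γ) (Δ : ℝ) :
    Δ * prob p {s | 2 ^ Δ * (prob p {t | B t = B s ∧ C t = C s} * prob p {t | A t = A s ∧ C t = C s})
      < prob p {t | A t = A s ∧ (B t, C t) = (B s, C s)} * prob p {t | C t = C s}} ≤
      condMutualInfo p A B C + 2 := by
  classical
  set w : α → β × γ → ℝ := fun a d => prob p {t | A t = a ∧ (B t, C t) = d} with hw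
  set wBC : β × γ → ℝ := fun d => prob p {t | (B t, C t) = d} with hwBC
  set wAC : α → γ → ℝ := fun a c => prob p {t | A t = a ∧ C t = c} with hwAC
  set wC : γ → ℝ := fun c => prob p {t | C t = c} with hwC
  have w0 : ∀ a d, 0 ≤ w a d := fun _ _ => prob_nonneg _ _
  have wBC0 : ∀ d, 0 ≤ wBC d := fun _ => prob_nonneg _ _
  have wAC0 : ∀ a c, 0 ≤ wAC a c := fun _ _ => prob_nonneg _ _
  have wC0 : ∀ c, 0 ≤ wC c := fun _ => prob_nonneg _ _
  have w_le_BC : ∀ a d, w a d ≤ wBC d := fun a d => prob_mono p fun s hs => hs.2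
  have w_le_AC : ∀ a d, w a d ≤ wAC a d.2 := fun a d => prob_mono p fun s hs => by
    refine ⟨hs.1, ?_⟩
    rw [← hs.2]
  have wAC_le : ∀ a c, wAC a c ≤ wC c := fun a c => prob_mono p fun s hs => hs.2
  have sumBC : HasSum wBC 1 := by
    have := hasSum_prob_fiber p (fun t => (B t, C t)) Set.univ
    simpa [prob_univ] using this
  have sumAC : ∀ c, ∑ a, wAC a c = wC c := fun c => sum_prob_fiber p A {t | C t = c}
  have sumW : ∀ a c, HasSum (fun b => w a (b, c)) (wAC a c) := by
    intro a c
    have := hasSum_prob_fiber p B {t | A t = a ∧ C t = c}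
    have e : (fun b => w a (b, c)) = fun b => prob p {s | B s = b ∧ s ∈ {t | A t = a ∧ C t = c}} := by
      funext b
      refine congrArg (prob p) (Set.ext fun t => ?_)
      simp only [Set.mem_ofPred_eq, Prod.mk.injEq]
      tauto
    rw [e]
    exact this
  have summW : ∀ a, Summable (w a) := fun a =>
    sumBC.summable.of_nonneg_of_le (w0 a) (w_le_BC a)
  -- the two conditional entropies as sums over the values of `(B, C)`
  have hAC : HasSum (fun d : β × γ => ∑ a, w a d * Real.logb 2 (wC d.2 / wAC a d.2))
      (condEntropy p A C) := by
    have e : condEntropy p A C = ∑ a, ∑ c, wAC a c * Real.logb 2 (wC c / wAC a c) := by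
      rw [condEntropy, tsum_fintype, Finset.sum_comm]
      exact Finset.sum_congr rfl fun c _ => entropy_condProb p A C c
    rw [e]
    refine hasSum_sum fun a _ => ?_
    have hs : Summable fun d : β × γ => w a d * Real.logb 2 (wC d.2 / wAC a d.2) := by
      refine Summable.of_norm_bounded
        ((summW a).mul_right (∑ c, |Real.logb 2 (wC c / wAC a c)|)) fun d => ?_
      rw [norm_mul, Real.norm_of_nonneg (w0 a d), Real.norm_eq_abs]
      exact mul_le_mul_of_nonneg_left (Finset.single_le_sum
        (f := fun c => |Real.logb 2 (wC c / wAC a c)|) (fun c _ => abs_nonneg _)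
        (Finset.mem_univ d.2)) (w0 a d)
    have h2 := ((Equiv.prodComm γ β).hasSum_iff.2 hs.hasSum).prod_fiberwise
      (g := fun c => wAC a c * Real.logb 2 (wC c / wAC a c)) fun c => (sumW a c).mul_right _
    rw [(hasSum_fintype _).unique h2]
    exact hs.hasSum
  have hBC : HasSum (fun d : β × γ => ∑ a, w a d * Real.logb 2 (wBC d / w a d))
      (condEntropy p A (fun s => (B s, C s))) := by
    have e : condEntropy p A (fun s => (B s, C s)) =
        ∑' d, ∑ a, w a d * Real.logb 2 (wBC d / w a d) :=
      tsum_congr fun d => entropy_condProb p A (fun s => (B s, C s)) d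
    rw [e]
    refine Summable.hasSum (summable_sum fun a _ => ?_)
    refine (sumBC.summable.mul_left 2).of_nonneg_of_le (fun d => ?_) fun d => ?_
    · rcases (w0 a d).eq_or_lt with h | h
      · simp [← h]
      · refine mul_nonneg h.le (Real.logb_nonneg one_lt_two ?_)
        rw [one_le_div h]
        exact w_le_BC a d
    · rcases (w0 a d).eq_or_lt with h | h
      · rw [← h]; simpa using wBC0 d
      · calc _ ≤ w a d * (2 * (wBC d / w a d)) := mul_le_mul_of_nonneg_left
              (logb_two_le _ (div_nonneg (wBC0 d) h.le)) h.le
          _ = 2 * wBC d := by field_simp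
  set bad : α → β × γ → Prop := fun a d => 2 ^ Δ * (wBC d * wAC a d.2) < w a d * wC d.2 with hbad
  have hprob : HasSum (fun d => ∑ a, if bad a d then w a d else 0)
      (prob p {s | bad (A s) (B s, C s)}) := by
    have := hasSum_prob_fiber p (fun t => (B t, C t)) {s | bad (A s) (B s, C s)}
    convert this using 2 with d
    rw [← sum_prob_fiber p A]
    refine Finset.sum_congr rfl fun a _ => ?_
    split_ifs with h
    · refine congrArg (prob p) (Set.ext fun t => ?_)
      constructor
      · rintro ⟨rfl, rfl⟩
        exact ⟨rfl, rfl, h⟩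
      · rintro ⟨rfl, h, -⟩
        exact ⟨rfl, h⟩
    · have : {s | A s = a ∧ s ∈ {s | (B s, C s) = d ∧ s ∈ {s | bad (A s) (B s, C s)}}} = ∅ := by
        ext t
        simp only [Set.mem_ofPred_eq, Set.mem_empty_iff_false, iff_false]
        rintro ⟨rfl, rfl, h'⟩
        exact h h'
      rw [this]
      simp [prob_eq_tsum]
  -- Information density exceeds `Δ` on `bad`. Its negative part costs at most `2 * wBC d` for each
  -- `d`, hence 2 in total.
  have main : ∀ d, Δ * (∑ a, if bad a d then w a d else 0) - 2 * wBC d ≤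
      (∑ a, w a d * Real.logb 2 (wC d.2 / wAC a d.2)) -
        ∑ a, w a d * Real.logb 2 (wBC d / w a d) := by
    intro d
    have point : ∀ a, Δ * (if bad a d then w a d else 0) - 2 * (wBC d * (wAC a d.2 / wC d.2)) ≤
        w a d * Real.logb 2 (wC d.2 / wAC a d.2) - w a d * Real.logb 2 (wBC d / w a d) := by
      intro a
      have hnn : 0 ≤ 2 * (wBC d * (wAC a d.2 / wC d.2)) :=
        mul_nonneg two_pos.le (mul_nonneg (wBC0 d) (div_nonneg (wAC0 _ _) (wC0 _)))
      rcases (w0 a d).eq_or_lt with h | h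
      · simpa [← h] using hnn
      have hBC := h.trans_le (w_le_BC a d)
      have hAC := h.trans_le (w_le_AC a d)
      have hC := hAC.trans_le (wAC_le a d.2)
      rw [← mul_sub, ← Real.logb_div (by positivity) (by positivity)]
      -- The inverse likelihood ratio: the density is `-logb 2 z ≥ -2 * z`, and `w * z` sums over
      -- `a` to at most `wBC d`.
      set z := wBC d * wAC a d.2 / (w a d * wC d.2) with hz
      have hzpos : 0 < z := by positivity
      have e1 : wC d.2 / wAC a d.2 / (wBC d / w a d) = z⁻¹ := by rw [hz]; field_simp
      have e2 : wBC d * (wAC a d.2 / wC d.2) = w a d * z := by rw [hz]; field_simp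
      rw [e1, e2, Real.logb_inv]
      split_ifs with hb
      · have : Real.logb 2 z ≤ - Δ := by
          rw [Real.logb_le_iff_le_rpow one_lt_two hzpos, Real.rpow_neg two_pos.le, hz,
            div_le_iff₀ (by positivity), inv_mul_eq_div, le_div_iff₀ (by positivity), mul_comm]
          exact hb.le
        nlinarith [mul_pos h hzpos]
      · have := logb_two_le z hzpos.le
        nlinarith
    calc _ ≤ ∑ a, (Δ * (if bad a d then w a d else 0) - 2 * (wBC d * (wAC a d.2 / wC d.2))) := by
          rw [Finset.sum_sub_distrib, ← Finset.mul_sum, ← Finset.mul_sum, ← Finset.mul_sum,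
            ← Finset.sum_div, sumAC]
          have := mul_le_of_le_one_right (wBC0 d) (div_self_le_one (wC d.2))
          linarith
      _ ≤ _ := by
          rw [← Finset.sum_sub_distrib]
          exact Finset.sum_le_sum fun a _ => point a
  have := hasSum_le main ((hprob.mul_left Δ).sub (sumBC.mul_left 2)) (hAC.sub hBC)
  have e : prob p {s | 2 ^ Δ * (prob p {t | B t = B s ∧ C t = C s} *
      prob p {t | A t = A s ∧ C t = C s}) <
      prob p {t | A t = A s ∧ (B t, C t) = (B s, C s)} * prob p {t | C t = C s}} =
      prob p {s | bad (A s) (B s, C s)} := by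
    simp only [hbad, hw, hwBC, hwAC, hwC, Prod.mk.injEq]
  rw [e, condMutualInfo]
  linarith

/-! ### Protocols: product form and transcript probabilities -/

open Classical in
lemma prob_eq_sum {S : Type*} [Fintype S] (p : PMF S) (E : Set S) :
    prob p E = ∑ s, (p s).toReal * (if s ∈ E then 1 else 0) := by
  have h := prob_bind p PMF.pure E
  rw [PMF.bind_pure] at h
  simp only [prob_pure] at h
  exact h.unique (hasSum_fintype _)

open Classical in
/-- The transcripts of a private-coin protocol have product form. -/
lemma PrivateProtocol.exists_product_form {X Y : Type*} (T : PrivateProtocol X Y) :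
    ∃ (ι : Type) (_ : Fintype ι) (τ : ι → List ℕ) (out : ι → Bool) (p : X → ι → ℝ) (q : Y → ι → ℝ),
      Function.Injective τ ∧ (∀ x j, 0 ≤ p x j) ∧ (∀ y j, 0 ≤ q y j) ∧
      ∀ x y (E : Set (List ℕ × Bool)),
        prob (T.run x y) E = ∑ j, p x j * q y j * (if (τ j, out j) ∈ E then 1 else 0) := by
  -- Injectivity of `τ` lets the message sequence determine the leaf, so that conditioning on the
  -- transcript isolates one product `p x j * q y j`.
  have glue : ∀ {k : ℕ} {ι : Fin k → Type} {τ : ∀ i, ι i → List ℕ},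
      (∀ i, Function.Injective (τ i)) →
      Function.Injective fun j : Σ i, ι i => (j.1 : ℕ) :: τ j.1 j.2 := by
    rintro k ι τ hτ ⟨i, j⟩ ⟨i', j'⟩ h
    obtain ⟨h1, h2⟩ := List.cons.inj h
    obtain rfl : i = i' := Fin.ext h1
    exact congrArg _ (hτ i h2)
  induction T with
  | leaf b =>
    refine ⟨Unit, inferInstance, fun _ => [], fun _ => b, fun _ _ => 1, fun _ _ => 1,
      fun _ _ _ => rfl, fun _ _ => zero_le_one, fun _ _ => zero_le_one, fun x y E => ?_⟩
    simp [PrivateProtocol.run, prob_pure]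
  | alice k message next ih =>
    choose ι hι τ out p q hτ hp hq h using ih
    refine ⟨Σ i, ι i, inferInstance, fun j => (j.1 : ℕ) :: τ j.1 j.2, fun j => out j.1 j.2,
      fun x j => (message x j.1).toReal * p j.1 x j.2, fun y j => q j.1 y j.2, glue hτ,
      fun x j => mul_nonneg ENNReal.toReal_nonneg (hp _ _ _), fun y j => hq _ _ _,
      fun x y E => ?_⟩
    rw [PrivateProtocol.run, (prob_bind _ _ _).unique (hasSum_fintype _), Fintype.sum_sigma]
    refine Finset.sum_congr rfl fun i _ => ?_
    rw [prob_map, h, Finset.mul_sum]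
    exact Finset.sum_congr rfl fun j _ => by simp only [Set.mem_preimage]; ring
  | bob k message next ih =>
    choose ι hι τ out p q hτ hp hq h using ih
    refine ⟨Σ i, ι i, inferInstance, fun j => (j.1 : ℕ) :: τ j.1 j.2, fun j => out j.1 j.2,
      fun x j => p j.1 x j.2, fun y j => (message y j.1).toReal * q j.1 y j.2, glue hτ,
      fun x j => hp _ _ _, fun y j => mul_nonneg ENNReal.toReal_nonneg (hq _ _ _),
      fun x y E => ?_⟩
    rw [PrivateProtocol.run, (prob_bind _ _ _).unique (hasSum_fintype _), Fintype.sum_sigma]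
    refine Finset.sum_congr rfl fun i _ => ?_
    rw [prob_map, h, Finset.mul_sum]
    exact Finset.sum_congr rfl fun j _ => by simp only [Set.mem_preimage]; ring

/-- The execution of a protocol for a fixed value of the public randomness. -/
noncomputable def Protocol.executionAt {X Y : Type*} (π : Protocol X Y) (μ : PMF (X × Y)) (r : π.Coins) :
    PMF ((X × Y) × (π.Coins × List ℕ) × Bool) :=
  μ.bind fun z => ((π.tree r).run z.1 z.2).map fun t => (z, (r, t.1), t.2)

lemma Protocol.hasSum_prob_execution {X Y : Type*} (π : Protocol X Y) (μ : PMF (X × Y))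
    (E : Set ((X × Y) × (π.Coins × List ℕ) × Bool)) :
    HasSum (fun r => (π.coins r).toReal * prob (π.executionAt μ r) E) (prob (π.execution μ) E) := by
  rw [Protocol.execution, PMF.bind_comm]
  exact prob_bind _ _ _

lemma Protocol.prob_execution_inputs {X Y : Type*} (π : Protocol X Y) (μ : PMF (X × Y))
    (Z : Set (X × Y)) : prob (π.execution μ) {s | s.1 ∈ Z} = prob μ Z := by
  refine (prob_map (π.execution μ) Prod.fst Z).symm.trans ?_
  congr 1
  simp only [Protocol.execution, PMF.map_bind, PMF.map_comp, Function.comp_def]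
  refine (congrArg μ.bind (funext fun z => ?_)).trans (PMF.bind_pure μ)
  refine (congrArg π.coins.bind (funext fun r => ?_)).trans (PMF.bind_const π.coins (PMF.pure z))
  exact PMF.map_const _ z

open Classical in
lemma Protocol.prob_executionAt {X Y ι : Type*} [Fintype X] [Fintype Y] [Fintype ι]
    (π : Protocol X Y) (μ : PMF (X × Y)) (r : π.Coins) {τ : ι → List ℕ} {out : ι → Bool}
    {p : X → ι → ℝ} {q : Y → ι → ℝ}
    (h : ∀ x y (E : Set (List ℕ × Bool)), prob ((π.tree r).run x y) E =
      ∑ j, p x j * q y j * (if (τ j, out j) ∈ E then 1 else 0))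
    (E : Set ((X × Y) × (π.Coins × List ℕ) × Bool)) :
    prob (π.executionAt μ r) E = ∑ x, ∑ y, ∑ j, (μ (x, y)).toReal * (p x j * q y j) *
      (if ((x, y), (r, τ j), out j) ∈ E then 1 else 0) := by
  rw [Protocol.executionAt, (prob_bind _ _ _).unique (hasSum_fintype _), Fintype.sum_prod_type]
  refine Finset.sum_congr rfl fun x _ => Finset.sum_congr rfl fun y _ => ?_
  rw [prob_map, h, Finset.mul_sum]
  exact Finset.sum_congr rfl fun j _ => by simp only [Set.mem_preimage]; ring

open Classical in
lemma Protocol.prob_execution_transcript {X Y ι : Type*} [Fintype X] [Fintype Y] [Fintype ι]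
    (π : Protocol X Y) (μ : PMF (X × Y)) (r : π.Coins) {τ : ι → List ℕ} {out : ι → Bool}
    {p : X → ι → ℝ} {q : Y → ι → ℝ} (hτ : Function.Injective τ)
    (h : ∀ x y (E : Set (List ℕ × Bool)), prob ((π.tree r).run x y) E =
      ∑ j, p x j * q y j * (if (τ j, out j) ∈ E then 1 else 0)) (j : ι) (Z : Set (X × Y)) :
    prob (π.execution μ) {s | s.1 ∈ Z ∧ s.2.1 = (r, τ j)} = (π.coins r).toReal *
      ∑ x, ∑ y, (μ (x, y)).toReal * (p x j * q y j) * (if (x, y) ∈ Z then 1 else 0) := by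
  have h1 := π.hasSum_prob_execution μ {s | s.1 ∈ Z ∧ s.2.1 = (r, τ j)}
  have h2 := hasSum_single (f := fun r' => (π.coins r').toReal *
    prob (π.executionAt μ r') {s | s.1 ∈ Z ∧ s.2.1 = (r, τ j)}) r fun r' hr => by
    have : prob (π.executionAt μ r') {s | s.1 ∈ Z ∧ s.2.1 = (r, τ j)} = 0 := by
      rw [Protocol.executionAt, (prob_bind _ _ _).unique (hasSum_fintype _)]
      refine Finset.sum_eq_zero fun z _ => ?_
      rw [prob_map]
      have : (fun t : List ℕ × Bool => (z, (r', t.1), t.2)) ⁻¹' {s | s.1 ∈ Z ∧ s.2.1 = (r, τ j)} =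
          ∅ := by
        ext t
        simp [hr]
      rw [this]
      simp [prob_eq_tsum]
    simp [this]
  rw [h1.unique h2, π.prob_executionAt μ r h]
  congr 1
  refine Finset.sum_congr rfl fun x _ => Finset.sum_congr rfl fun y _ => ?_
  rw [Finset.sum_eq_single j]
  · simp
  · intro j' _ hj
    have : τ j' ≠ τ j := fun e => hj (hτ e)
    simp [this]
  · simp

/-! ### Discrepancy as a cut norm -/

lemma bddAbove_discrepancy {X Y : Type*} (f : X → Y → Bool) (μ : PMF (X × Y)) :
    BddAbove (Set.range fun R : {R : Set (X × Y) // IsRectangle R} =>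
      |prob μ {z | f z.1 z.2 = false ∧ z ∈ R.1} - prob μ {z | f z.1 z.2 = true ∧ z ∈ R.1}|) := by
  refine ⟨1, ?_⟩
  rintro _ ⟨R, rfl⟩
  have h1 := prob_nonneg μ {z | f z.1 z.2 = false ∧ z ∈ R.1}
  have h2 := prob_le_one μ {z | f z.1 z.2 = false ∧ z ∈ R.1}
  have h3 := prob_nonneg μ {z | f z.1 z.2 = true ∧ z ∈ R.1}
  have h4 := prob_le_one μ {z | f z.1 z.2 = true ∧ z ∈ R.1}
  exact abs_le.2 ⟨by linarith, by linarith⟩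

lemma abs_cut_le_discrepancy {X Y : Type*} [Fintype X] [Fintype Y] (f : X → Y → Bool)
    (μ : PMF (X × Y)) (S : Finset X) (T : Finset Y) :
    |∑ x ∈ S, ∑ y ∈ T, (μ (x, y)).toReal * boolSign (f x y)| ≤ discrepancy f μ := by
  classical
  have hR : IsRectangle {z : X × Y | z.1 ∈ S ∧ z.2 ∈ T} := fun x₁ y₁ x₂ y₂ h1 h2 => ⟨h1.1, h2.2⟩
  refine le_trans (le_of_eq ?_) (le_ciSup (bddAbove_discrepancy f μ) ⟨_, hR⟩)
  congr 1
  rw [prob_eq_sum, prob_eq_sum, ← Finset.sum_sub_distrib, Fintype.sum_prod_type,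
    ← Finset.sum_subset (Finset.subset_univ S)]
  · refine Finset.sum_congr rfl fun x hx => ?_
    rw [← Finset.sum_subset (Finset.subset_univ T)]
    · refine Finset.sum_congr rfl fun y hy => ?_
      cases hf : f x y <;> simp [hf, hx, hy, boolSign]
    · intro y _ hy
      simp [hy]
  · intro x _ hx
    simp [hx]

/-! ### Advantage of a protocol against discrepancy -/

/-- The event that the transcript multiplies the probability of Alice's input given Bob's by more
than `K`. -/
def Protocol.revealsX {X Y : Type*} (π : Protocol X Y) (μ : PMF (X × Y)) (K : ℝ) :
    Set ((X × Y) × (π.Coins × List ℕ) × Bool) :=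
  {s | K * (prob (π.execution μ) {t | t.2.1 = s.2.1 ∧ t.1.2 = s.1.2} *
      prob (π.execution μ) {t | t.1.1 = s.1.1 ∧ t.1.2 = s.1.2}) <
    prob (π.execution μ) {t | t.1.1 = s.1.1 ∧ (t.2.1, t.1.2) = (s.2.1, s.1.2)} *
      prob (π.execution μ) {t | t.1.2 = s.1.2}}

/-- The event that the transcript multiplies the probability of Bob's input given Alice's by more
than `K`. -/
def Protocol.revealsY {X Y : Type*} (π : Protocol X Y) (μ : PMF (X × Y)) (K : ℝ) :
    Set ((X × Y) × (π.Coins × List ℕ) × Bool) :=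
  {s | K * (prob (π.execution μ) {t | t.2.1 = s.2.1 ∧ t.1.1 = s.1.1} *
      prob (π.execution μ) {t | t.1.2 = s.1.2 ∧ t.1.1 = s.1.1}) <
    prob (π.execution μ) {t | t.1.2 = s.1.2 ∧ (t.2.1, t.1.1) = (s.2.1, s.1.1)} *
      prob (π.execution μ) {t | t.1.1 = s.1.1}}

/-- The surprise events refer to the whole execution, but the transcript contains `r`. The mass of
`r` is therefore a common factor of both sides of their defining inequalities and cancels, leaving
the hypotheses of `advantage_le_cut`. -/
lemma Protocol.advantage_executionAt_le {X Y : Type*} [Fintype X] [Fintype Y] (π : Protocol X Y)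
    (μ : PMF (X × Y)) (f : X → Y → Bool) {K : ℝ} (hK : 0 < K) (r : π.Coins)
    (hr : 0 < (π.coins r).toReal) :
    1 - 2 * prob (π.executionAt μ r) {s | s.2.2 ≠ f s.1.1 s.1.2} -
      prob (π.executionAt μ r) (π.revealsX μ K) - prob (π.executionAt μ r) (π.revealsY μ K) ≤
      32 * (K * discrepancy f μ) := by
  classical
  obtain ⟨ι, hι, τ, out, p, q, hτ, hp, hq, h⟩ := (π.tree r).exists_product_form
  have hpq : ∀ x y, ∑ j, p x j * q y j = 1 := fun x y => by
    simpa [prob_univ] using (h x y Set.univ).symm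
  have hsign : ∀ b : Bool, boolSign b = 1 ∨ boolSign b = -1 := by
    intro b; cases b <;> simp [boolSign]
  have hcoin : prob (π.executionAt μ r) Set.univ = 1 := prob_univ _
  set m : X → Y → ℝ := fun x y => (μ (x, y)).toReal with hm
  have hm0 : ∀ x y, 0 ≤ m x y := fun _ _ => ENNReal.toReal_nonneg
  have hT := fun j Z => π.prob_execution_transcript μ r hτ h j Z
  have hX : ∀ x, prob (π.execution μ) {t | t.1.1 = x} = ∑ y, m x y := by
    intro x
    refine (π.prob_execution_inputs μ {z | z.1 = x}).trans ?_
    rw [prob_eq_sum, Fintype.sum_prod_type,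
      Finset.sum_eq_single x (fun b _ hb => by simp [hb]) (by simp)]
    simp [hm]
  have hY : ∀ y, prob (π.execution μ) {t | t.1.2 = y} = ∑ x, m x y := by
    intro y
    refine (π.prob_execution_inputs μ {z | z.2 = y}).trans ?_
    rw [prob_eq_sum, Fintype.sum_prod_type]
    refine Finset.sum_congr rfl fun x _ => ?_
    rw [Finset.sum_eq_single y (fun b _ hb => by simp [hb]) (by simp)]
    simp [hm]
  have hXY : ∀ x y, prob (π.execution μ) {t | t.1.1 = x ∧ t.1.2 = y} = m x y := by
    intro x y
    refine (π.prob_execution_inputs μ {z | z.1 = x ∧ z.2 = y}).trans ?_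
    rw [prob_eq_sum, Finset.sum_eq_single (x, y) (fun b _ hb => ?_) (by simp)]
    · simp [hm]
    · have : ¬ (b.1 = x ∧ b.2 = y) := fun h => hb (Prod.ext h.1 h.2)
      simp [this]
  have hXT : ∀ x j, prob (π.execution μ) {t | t.1.1 = x ∧ t.2.1 = (r, τ j)} =
      (π.coins r).toReal * (p x j * ∑ y, m x y * q y j) := by
    intro x j
    refine (hT j {z | z.1 = x}).trans ?_
    rw [Finset.sum_eq_single x (fun b _ hb => by simp [hb]) (by simp)]
    refine congrArg _ ?_
    rw [Finset.mul_sum]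
    refine Finset.sum_congr rfl fun y _ => ?_
    rw [if_pos (by simp)]
    ring
  have hYT : ∀ y j, prob (π.execution μ) {t | t.1.2 = y ∧ t.2.1 = (r, τ j)} =
      (π.coins r).toReal * (q y j * ∑ x, m x y * p x j) := by
    intro y j
    refine (hT j {z | z.2 = y}).trans ?_
    refine congrArg _ ?_
    rw [Finset.mul_sum]
    refine Finset.sum_congr rfl fun x _ => ?_
    rw [Finset.sum_eq_single y (fun b _ hb => by simp [hb]) (by simp), if_pos (by simp)]
    ring
  have hXYT : ∀ x y j, prob (π.execution μ) {t | (t.1.1 = x ∧ t.1.2 = y) ∧ t.2.1 = (r, τ j)} =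
      (π.coins r).toReal * (m x y * (p x j * q y j)) := by
    intro x y j
    refine (hT j {z | z.1 = x ∧ z.2 = y}).trans ?_
    rw [Finset.sum_eq_single x (fun b _ hb => by simp [hb]) (by simp),
      Finset.sum_eq_single y (fun b _ hb => by simp [hb]) (by simp), if_pos (by simp), mul_one]
  have key := advantage_le_cut m (fun x y => boolSign (f x y)) hK hm0 (fun x y => hsign _)
    (abs_cut_le_discrepancy f μ) p q hp hq hpq (fun j => boolSign (out j)) (fun j => hsign _)
    (fun x y j => ((x, y), (r, τ j), out j) ∈ π.revealsX μ K)
    (fun x y j => ((x, y), (r, τ j), out j) ∈ π.revealsY μ K) ?_ ?_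
  · refine le_trans (le_of_eq ?_) key
    refine (congrArg (fun t => t - _ - _ - _) hcoin.symm).trans ?_
    rw [π.prob_executionAt μ r h, π.prob_executionAt μ r h, π.prob_executionAt μ r h,
      π.prob_executionAt μ r h]
    simp only [Finset.mul_sum, ← Finset.sum_sub_distrib]
    refine Finset.sum_congr rfl fun x _ => Finset.sum_congr rfl fun y _ =>
      Finset.sum_congr rfl fun j _ => ?_
    have : (out j ≠ f x y) ↔ (boolSign (f x y) ≠ boolSign (out j)) := by
      cases out j <;> cases f x y <;> simp [boolSign] <;> norm_num
    simp only [Set.mem_univ, if_true, Set.mem_ofPred_eq, this]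
    ring
  · intro x y j hpos hbad
    rw [Protocol.revealsX, Set.mem_ofPred_eq, not_lt] at hbad
    change prob (π.execution μ) {t | t.1.1 = x ∧ (t.2.1, t.1.2) = ((r, τ j), y)} *
      prob (π.execution μ) {t | t.1.2 = y} ≤ K *
      (prob (π.execution μ) {t | t.2.1 = (r, τ j) ∧ t.1.2 = y} *
        prob (π.execution μ) {t | t.1.1 = x ∧ t.1.2 = y}) at hbad
    simp only [Prod.mk.injEq (_ : π.Coins × List ℕ) (_ : Y)] at hbad
    rw [hY, hXY, show {t : (X × Y) × (π.Coins × List ℕ) × Bool | t.2.1 = (r, τ j) ∧ t.1.2 = y} =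
      {t | t.1.2 = y ∧ t.2.1 = (r, τ j)} from Set.ext fun t => and_comm, hYT,
      show {t : (X × Y) × (π.Coins × List ℕ) × Bool | t.1.1 = x ∧ t.2.1 = (r, τ j) ∧ t.1.2 = y} =
      {t | (t.1.1 = x ∧ t.1.2 = y) ∧ t.2.1 = (r, τ j)} from Set.ext fun t =>
        ⟨fun h => ⟨⟨h.1, h.2.2⟩, h.2.1⟩, fun h => ⟨h.1.1, h.2, h.1.2⟩⟩, hXYT] at hbad
    have hmpos : 0 < m x y := (hm0 x y).lt_of_ne' fun h => by simp [h] at hpos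
    have hqpos : 0 < q y j := (hq y j).lt_of_ne' fun h => by simp [h] at hpos
    -- Both sides of `hbad` carry the factor `Pr[r] * m x y * q y j`; what remains compares `p` with
    -- Bob's prediction.
    refine le_of_mul_le_mul_left ?_ (mul_pos hr (mul_pos hmpos hqpos))
    linarith
  · intro x y j hpos hbad
    rw [Protocol.revealsY, Set.mem_ofPred_eq, not_lt] at hbad
    change prob (π.execution μ) {t | t.1.2 = y ∧ (t.2.1, t.1.1) = ((r, τ j), x)} *
      prob (π.execution μ) {t | t.1.1 = x} ≤ K *
      (prob (π.execution μ) {t | t.2.1 = (r, τ j) ∧ t.1.1 = x} *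
        prob (π.execution μ) {t | t.1.2 = y ∧ t.1.1 = x}) at hbad
    simp only [Prod.mk.injEq (_ : π.Coins × List ℕ) (_ : X)] at hbad
    rw [hX, show {t : (X × Y) × (π.Coins × List ℕ) × Bool | t.1.2 = y ∧ t.1.1 = x} =
      {t | t.1.1 = x ∧ t.1.2 = y} from Set.ext fun t => and_comm, hXY,
      show {t : (X × Y) × (π.Coins × List ℕ) × Bool | t.2.1 = (r, τ j) ∧ t.1.1 = x} =
      {t | t.1.1 = x ∧ t.2.1 = (r, τ j)} from Set.ext fun t => and_comm, hXT,
      show {t : (X × Y) × (π.Coins × List ℕ) × Bool | t.1.2 = y ∧ t.2.1 = (r, τ j) ∧ t.1.1 = x} =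
      {t | (t.1.1 = x ∧ t.1.2 = y) ∧ t.2.1 = (r, τ j)} from Set.ext fun t =>
        ⟨fun h => ⟨⟨h.2.2, h.1⟩, h.2.1⟩, fun h => ⟨h.1.2, h.2, h.1.1⟩⟩, hXYT] at hbad
    have hmpos : 0 < m x y := (hm0 x y).lt_of_ne' fun h => by simp [h] at hpos
    have hppos : 0 < p x j := (hp x j).lt_of_ne' fun h => by simp [h] at hpos
    refine le_of_mul_le_mul_left ?_ (mul_pos hr (mul_pos hmpos hppos))
    linarith

/-- The bound for fixed coins is linear in the probabilities, so it averages over `r`; coins of mass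
0 contribute nothing. -/
lemma Protocol.advantage_le {X Y : Type*} [Fintype X] [Fintype Y] (π : Protocol X Y)
    (μ : PMF (X × Y)) (f : X → Y → Bool) {K : ℝ} (hK : 0 < K) :
    1 - 2 * π.error μ f - prob (π.execution μ) (π.revealsX μ K) -
      prob (π.execution μ) (π.revealsY μ K) ≤ 32 * (K * discrepancy f μ) := by
  have h0 := π.hasSum_prob_execution μ Set.univ
  simp only [prob_univ, mul_one] at h0
  have h1 := π.hasSum_prob_execution μ {s | s.2.2 ≠ f s.1.1 s.1.2}
  have h2 := π.hasSum_prob_execution μ (π.revealsX μ K)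
  have h3 := π.hasSum_prob_execution μ (π.revealsY μ K)
  have := hasSum_le (fun r => ?_) (((h0.sub (h1.mul_left 2)).sub h2).sub h3)
    (h0.mul_right (32 * (K * discrepancy f μ)))
  · simpa [Protocol.error] using this
  · rcases (ENNReal.toReal_nonneg (a := π.coins r)).eq_or_lt with h | h
    · simp [← h]
    · have := mul_le_mul_of_nonneg_left (π.advantage_executionAt_le μ f hK r h) h.le
      linarith

/-! ### From information cost to discrepancy -/

lemma Protocol.logb_discrepancy_le {X Y : Type*} [Fintype X] [Fintype Y] (π : Protocol X Y)
    (μ : PMF (X × Y)) (f : X → Y → Bool) (h : π.error μ f ≤ 1 / 10) :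
    0 < discrepancy f μ ∧ Real.logb 2 (1 / discrepancy f μ) ≤ 10 * π.infoCost μ + 56 := by
  set I := π.infoCost μ with hI
  set b := prob (π.execution μ) (π.revealsX μ (2 ^ (10 * (I + 5)))) +
    prob (π.execution μ) (π.revealsY μ (2 ^ (10 * (I + 5)))) with hb
  have markov : ∀ Δ : ℝ, Δ * (prob (π.execution μ) (π.revealsX μ (2 ^ Δ)) +
      prob (π.execution μ) (π.revealsY μ (2 ^ Δ))) ≤ I + 4 := by
    intro Δ
    have h1 := mul_prob_surprise_le (π.execution μ) (fun s => s.1.1) (fun s => s.2.1)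
      (fun s => s.1.2) Δ
    have h2 := mul_prob_surprise_le (π.execution μ) (fun s => s.1.2) (fun s => s.2.1)
      (fun s => s.1.1) Δ
    have e : I = _ + _ := rfl
    rw [e, mul_add]
    calc _ ≤ _ := add_le_add h1 h2
      _ = _ := by ring
  have hIpos : 0 ≤ I + 4 := by simpa using markov 0
  -- `Δ = 10 * (I + 5)` makes `(I + 4) / Δ` less than `1 / 10`. The case `Δ = 0` of `markov` already
  -- gave `I ≥ -4`, so `Δ` is positive without nonnegativity of information.
  have hb1 : b ≤ 1 / 10 := by
    have := markov (10 * (I + 5))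
    rw [← hb] at this
    by_contra hlt
    push Not at hlt
    nlinarith
  have hK : (0 : ℝ) < 2 ^ (10 * (I + 5)) := by positivity
  have adv := π.advantage_le μ f hK
  have hlow : (7 / 10 : ℝ) ≤ 32 * (2 ^ (10 * (I + 5)) * discrepancy f μ) := by linarith
  have hd : 0 < discrepancy f μ := by
    by_contra hneg
    push Not at hneg
    nlinarith [mul_nonneg hK.le (neg_nonneg.2 hneg)]
  refine ⟨hd, ?_⟩
  rw [Real.logb_le_iff_le_rpow one_lt_two (by positivity), div_le_iff₀ hd]
  -- The advantage is at least `1 - 2 / 10 - 1 / 10 = 7 / 10`, and `32 / (7 / 10) ≤ 64 = 2 ^ 6`.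
  have e : (2 : ℝ) ^ (10 * I + 56) = 2 ^ (10 * (I + 5)) * 64 := by
    rw [show 10 * I + 56 = 10 * (I + 5) + 6 by ring, Real.rpow_add two_pos]
    norm_num
  rw [e]
  linarith

/-- The protocol in which both players send their inputs. -/
lemma exists_protocol_error_le {X Y : Type*} [Fintype X] [Fintype Y] (f : X → Y → Bool)
    (μ : PMF (X × Y)) : ∃ π : Protocol X Y, π.error μ f ≤ 1 / 10 := by
  classical
  let eX := Fintype.equivFin X
  let eY := Fintype.equivFin Y
  let T : PrivateProtocol X Y := .alice (Fintype.card X) (fun x => PMF.pure (eX x)) fun i =>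
    .bob (Fintype.card Y) (fun y => PMF.pure (eY y)) fun j => .leaf (f (eX.symm i) (eY.symm j))
  refine ⟨⟨Unit, PMF.pure (), fun _ => T⟩, ?_⟩
  have hrun : ∀ x y, T.run x y = PMF.pure ([(eX x : ℕ), (eY y : ℕ)], f x y) := by
    intro x y
    simp [T, PrivateProtocol.run, PMF.pure_bind, PMF.pure_map]
  have : Protocol.error ⟨Unit, PMF.pure (), fun _ => T⟩ μ f = 0 := by
    rw [Protocol.error, Protocol.execution, (prob_bind _ _ _).unique (hasSum_fintype _)]
    refine Finset.sum_eq_zero fun z _ => ?_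
    simp [hrun, PMF.pure_bind, PMF.pure_map, prob_pure]
  rw [this]
  norm_num

theorem theorem1 :
    ∃ c : ℝ, 0 < c ∧ ∃ δ : ℝ, 0 < δ ∧
      ∀ (X : Type*) (Y : Type*) [Fintype X] [Fintype Y] (f : X → Y → Bool) (μ : PMF (X × Y)),
        discrepancy f μ ≤ δ →
          c * Real.logb 2 (1 / discrepancy f μ) ≤ infoComplexity f μ (1 / 10) := by
  -- For `L = logb 2 (1 / Disc) ≥ 112` the additive 56 is at most `L / 2`, so `L ≤ 10 * I + 56`
  -- gives `L / 20 ≤ I`.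
  refine ⟨1 / 20, by norm_num, 2 ^ (-112 : ℝ), by positivity, ?_⟩
  intro X Y _ _ f μ hδ
  -- Nonemptiness matters: the real infimum of the empty set is 0.
  refine le_csInf ?_ ?_
  · obtain ⟨π, hπ⟩ := exists_protocol_error_le f μ
    exact ⟨_, π, hπ, rfl⟩
  · rintro _ ⟨π, hπ, rfl⟩
    obtain ⟨hd, hle⟩ := π.logb_discrepancy_le μ f hπ
    have hge : 112 ≤ Real.logb 2 (1 / discrepancy f μ) := by
      rw [one_div, Real.logb_inv, le_neg, Real.logb_le_iff_le_rpow one_lt_two hd]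
      exact hδ
    linarith
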